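/- Let $(X,\mathcal B,\mu)$ be a standard Borel probability space and let $\mathrm{Aut}(X,\mathcal B,\mu)$ be the group of measure-preserving automorphisms of it, identified when they agree almost everywhere, with the strong operator topology coming from the operators $f\mapsto f\circ S$ on $L^2(X,\mathcal B,\mu)$. Let $\mathcal T=(T_t)_{t\in\mathbb R}$ be a measure-preserving flow on $X$ which is measurable (the map $(x,t)\mapsto T_tx$ is measurable), ergodic and free (for almost every $x$, $T_tx\neq x$ for all $t\neq 0$). For an ergodic measurable measure-preserving flow $(T'_t)$ on a $\sigma$-compact metric space $(X',d)$ with a Borel probability measure $\mu'$, a finite set $P\subset\mathbb R\setminus\{0\}$ and $t_0\in\mathbb R\setminus\{0\}$, say that $(T'_t)$ has the $R(t_0,P)$-property if for every $\varepsilon>0$ there is $\kappa=\kappa(\varepsilon)>0$ such that for every $N\in\mathbb N$ there are $\delta=\delta(\varepsilon,N)>0$ and a measurable set $Z=Z(\varepsilon,N)\subset X'$ with $\mu'(Z)>1-\varepsilon$ such that for all $x,y\in Z$ with $x$ not in the orbit of $y$ and $d(x,y)<\delta$ there exist natural numbers $M,L\ge N$ with $L/M\ge\kappa$ and $p\in P$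 for which $$\frac1L\,\bigl|\{n\in\mathbb Z\cap[M,M+L] : d(T'_{nt_0}x,\,T'_{nt_0+p}y)<\varepsilon\}\bigr|>1-\varepsilon .$$ Say that $(T'_t)$ has Ratner's property with the set $P$ if $\{s\in\mathbb R\setminus\{0\} : (T'_t)\text{ has the } R(s,P)\text{-property}\}$ is uncountable. The flow $\mathcal T$ has (finite) Ratner's property if, for some finite $P\subset\mathbb R\setminus\{0\}$, it is measure-theoretically isomorphic to such a flow $(T'_t)$ that has Ratner's property with the set $P$. Assume that $\mathcal T$ has Ratner's property. Let $C(\mathcal T)=\{S\in\mathrm{Aut}(X,\mathcal B,\mu) : ST_t=T_tS\text{ for all }t\in\mathbb R\}$. Then the essential centralizer $EC(\mathcal T)=C(\mathcal T)/\{T_t : t\in\mathbb R\}$, with the quotient topology, is discrete and countable. -/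

import Mathlib

open MeasureTheory Set Filter Topology

universe u v

noncomputable section

namespace RatnerFlow

section Automorphisms

variable {X : Type u} [MeasurableSpace X]

/-- The group of bimeasurable bijections of `X` that preserve `μ`. -/
def mpPerm (μ : Measure X) : Subgroup (Equiv.Perm X) where
  carrier := {e | MeasurePreserving (fun x => e x) μ μ ∧ MeasurePreserving (fun x => e⁻¹ x) μ μ}
  mul_mem' := by
    rintro a b ⟨ha, ha'⟩ ⟨hb, hb'⟩
    refine ⟨ha.comp hb, ?_⟩
    rw [mul_inv_rev]
    exact hb'.comp ha'
  one_mem' := ⟨MeasurePreserving.id μ, by rw [inv_one]; exact MeasurePreserving.id μ⟩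
  inv_mem' := by
    rintro a ⟨ha, ha'⟩
    refine ⟨ha', ?_⟩
    rw [inv_inv]
    exact ha

/-- The elements of `mpPerm μ` that are almost everywhere equal to the identity. -/
def aeTrivial (μ : Measure X) : Subgroup (mpPerm μ) where
  carrier := {e | ∀ᵐ x ∂μ, e.1 x = x}
  mul_mem' := by
    intro a b ha hb
    have ha : ∀ᵐ x ∂μ, a.1 x = x := ha
    have hb : ∀ᵐ x ∂μ, b.1 x = x := hb
    show ∀ᵐ x ∂μ, a.1 (b.1 x) = x
    filter_upwards [ha, hb] with x h1 h2
    rw [h2, h1]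
  one_mem' := by
    show ∀ᵐ x ∂μ, (1 : Equiv.Perm X) x = x
    exact Eventually.of_forall fun _ => rfl
  inv_mem' := by
    intro a ha
    have ha : ∀ᵐ x ∂μ, a.1 x = x := ha
    show ∀ᵐ x ∂μ, a.1⁻¹ x = x
    filter_upwards [ha] with x h
    rw [Equiv.Perm.inv_eq_iff_eq]
    exact h.symm

instance aeTrivial_normal (μ : Measure X) : (aeTrivial μ).Normal where
  conj_mem := by
    intro n hn g
    have hn : ∀ᵐ x ∂μ, n.1 x = x := hn
    show ∀ᵐ x ∂μ, g.1 (n.1 (g.1⁻¹ x)) = x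
    filter_upwards [g.2.2.quasiMeasurePreserving.ae hn] with x h
    rw [h]
    exact g.1.apply_symm_apply x

/-- `Aut(X, μ)`: measure-preserving automorphisms, identified when they agree almost everywhere. -/
def Aut (μ : Measure X) : Type u := mpPerm μ ⧸ aeTrivial μ

instance (μ : Measure X) : Group (Aut μ) :=
  inferInstanceAs (Group (mpPerm μ ⧸ aeTrivial μ))

/-- The class in `Aut(X, μ)` of a pointwise defined automorphism. -/
def Aut.mk (μ : Measure X) : mpPerm μ →* Aut μ := QuotientGroup.mk' (aeTrivial μ)

theorem inv_mul_mem_aeTrivial_iff {μ : Measure X} (a b : mpPerm μ) :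
    a⁻¹ * b ∈ aeTrivial μ ↔ (fun x => a.1 x) =ᵐ[μ] (fun x => b.1 x) := by
  have key : ∀ x, (a⁻¹ * b).1 x = x ↔ a.1 x = b.1 x := by
    intro x
    show a.1⁻¹ (b.1 x) = x ↔ a.1 x = b.1 x
    rw [Equiv.Perm.inv_eq_iff_eq]
    exact eq_comm
  show (∀ᵐ x ∂μ, (a⁻¹ * b).1 x = x) ↔ ∀ᵐ x ∂μ, a.1 x = b.1 x
  simp only [key]

theorem Aut.mk_eq_mk_iff {μ : Measure X} (a b : mpPerm μ) :
    Aut.mk μ a = Aut.mk μ b ↔ (fun x => a.1 x) =ᵐ[μ] (fun x => b.1 x) :=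
  QuotientGroup.eq.trans (inv_mul_mem_aeTrivial_iff a b)

/-- The operator `f ↦ f ∘ S` on complex `L²(X, μ)` given by `S ∈ Aut(X, μ)`. -/
def Aut.koopman {μ : Measure X} (S : Aut μ) : Lp ℂ 2 μ → Lp ℂ 2 μ :=
  Quotient.lift
    (fun e : mpPerm μ => fun f : Lp ℂ 2 μ => Lp.compMeasurePreserving (fun x => e.1 x) e.2.1 f)
    (by
      intro a b hab
      have h := (inv_mul_mem_aeTrivial_iff a b).1 (QuotientGroup.leftRel_apply.1 hab)
      funext f
      apply Subtype.ext
      exact AEEqFun.compMeasurePreserving_congr f.1 a.2.1 b.2.1.measurable h) S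

/-- The strong operator topology on `Aut(X, μ)`: pointwise convergence, in the norm of `L²`,
of the operators `f ↦ f ∘ S`. -/
instance (μ : Measure X) : TopologicalSpace (Aut μ) :=
  TopologicalSpace.induced (fun S : Aut μ => (S.koopman : Lp ℂ 2 μ → Lp ℂ 2 μ)) inferInstance

end Automorphisms

/-!
A measurable measure-preserving flow `T_t x = t +ᵥ x` on `(X, μ)` is an action of the additive
group `ℝ` on `X` for which `(t, x) ↦ T_t x` is measurable (`MeasurableVAdd₂ ℝ X`) and every `T_t`
preserves `μ` (`VAddInvariantMeasure ℝ X μ`); it is ergodic if `ErgodicVAdd ℝ X μ`.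
-/

section Flow

variable {X : Type u} [MeasurableSpace X] [AddAction ℝ X] [MeasurableVAdd₂ ℝ X]

/-- The flow is free: almost every point has trivial stabilizer. -/
def IsFree (μ : Measure X) : Prop :=
  ∀ᵐ x ∂μ, ∀ t : ℝ, t ≠ 0 → t +ᵥ x ≠ x

variable (μ : Measure X) [VAddInvariantMeasure ℝ X μ]

/-- The time-`t` map of the flow as a measure-preserving bijection. -/
def timePerm (t : ℝ) : mpPerm μ :=
  ⟨AddAction.toPerm t, measurePreserving_vadd t μ, measurePreserving_vadd (-t) μ⟩

/-- The flow as a homomorphism `t ↦ T_t` from `ℝ` to `Aut(X, μ)`. -/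
def flowHom : Multiplicative ℝ →* Aut μ where
  toFun t := Aut.mk μ (timePerm μ t.toAdd)
  map_one' := by
    rw [← map_one (Aut.mk μ)]
    congr 1
    apply Subtype.ext
    ext x
    exact zero_vadd ℝ x
  map_mul' s t := by
    rw [← map_mul]
    congr 1
    apply Subtype.ext
    ext x
    exact add_vadd s.toAdd t.toAdd x

/-- The centralizer `C(T)` of the flow: all `S ∈ Aut(X, μ)` with `S T_t = T_t S` for all `t`. -/
def centralizer : Subgroup (Aut μ) :=
  Subgroup.centralizer (Set.range (flowHom μ))

/-- The subgroup `{T_t : t ∈ ℝ}` of `C(T)`. -/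
def timeSubgroup : Subgroup (centralizer μ) :=
  (flowHom μ).range.subgroupOf (centralizer μ)

instance timeSubgroup_normal : (timeSubgroup μ).Normal where
  conj_mem := by
    intro n hn g
    have hn' : n.1 ∈ (flowHom μ).range := hn
    have hc : n.1 * g.1 = g.1 * n.1 := Subgroup.mem_centralizer_iff.1 g.2 n.1 hn'
    have : g * n * g⁻¹ = n := by
      apply Subtype.ext
      show g.1 * n.1 * g.1⁻¹ = n.1
      rw [← hc, mul_inv_cancel_right]
    rwa [this]

/-- The essential centralizer `EC(T) = C(T) / {T_t : t ∈ ℝ}`, a group with the quotient of the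
strong operator topology. -/
abbrev EssentialCentralizer : Type u := centralizer μ ⧸ timeSubgroup μ

end Flow

section Ratner

/-- The property `R(t₀, P)` of a flow on a metric probability space. -/
def PropertyR {X : Type u} [MetricSpace X] [MeasurableSpace X] [AddAction ℝ X]
    (μ : Measure X) (t₀ : ℝ) (P : Finset ℝ) : Prop :=
  ∀ ε : ℝ, 0 < ε → ∃ κ : ℝ, 0 < κ ∧ ∀ N : ℕ, ∃ δ : ℝ, 0 < δ ∧ ∃ Z : Set X,
    MeasurableSet Z ∧ 1 - ε < μ.real Z ∧
    ∀ x ∈ Z, ∀ y ∈ Z, x ∉ AddAction.orbit ℝ y → dist x y < δ →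
      ∃ M L : ℕ, N ≤ M ∧ N ≤ L ∧ κ ≤ (L : ℝ) / (M : ℝ) ∧ ∃ p ∈ P,
        1 - ε < (1 / (L : ℝ)) *
          (((Finset.Icc M (M + L)).filter fun n : ℕ =>
            dist ((((n : ℝ) * t₀) +ᵥ x : X)) (((n : ℝ) * t₀ + p) +ᵥ y) < ε).card : ℝ)

/-- Ratner's property with the finite set `P`, for a flow on a metric probability space. -/
def MetricRatnerWith {X : Type u} [MetricSpace X] [MeasurableSpace X] [AddAction ℝ X]
    (μ : Measure X) (P : Finset ℝ) : Prop :=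
  (0 : ℝ) ∉ P ∧ ¬ {s : ℝ | s ≠ 0 ∧ PropertyR μ s P}.Countable

/-- Measure-theoretic isomorphism of two flows: a measure-preserving map, invertible modulo null
sets, that intertwines the time-`t` maps almost everywhere, for every `t`. -/
def FlowIsomorphic {X : Type u} {Y : Type v} [MeasurableSpace X] [MeasurableSpace Y]
    [AddAction ℝ X] [AddAction ℝ Y] (μ : Measure X) (ν : Measure Y) : Prop :=
  ∃ (φ : X → Y) (ψ : Y → X), MeasurePreserving φ μ ν ∧ MeasurePreserving ψ ν μ ∧
    (∀ᵐ x ∂μ, ψ (φ x) = x) ∧ (∀ᵐ y ∂ν, φ (ψ y) = y) ∧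
    ∀ t : ℝ, ∀ᵐ x ∂μ, φ (t +ᵥ x) = t +ᵥ φ x

/-- The (finite) Ratner property of a flow on a probability space: for some finite set `P` not
containing `0`, the flow is isomorphic to a measurable ergodic measure-preserving flow on a
σ-compact metric space, with a Borel probability measure, that has Ratner's property with `P`. -/
def HasRatnerProperty {X : Type u} [MeasurableSpace X] [AddAction ℝ X] (μ : Measure X) : Prop :=
  ∃ (P : Finset ℝ) (Y : Type v) (_ : MetricSpace Y) (_ : SigmaCompactSpace Y)
    (_ : MeasurableSpace Y) (_ : BorelSpace Y) (_ : AddAction ℝ Y) (_ : MeasurableVAdd₂ ℝ Y)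
    (ν : Measure Y) (_ : IsProbabilityMeasure ν) (_ : ErgodicVAdd ℝ Y ν),
    FlowIsomorphic μ ν ∧ MetricRatnerWith ν P

end Ratner

end RatnerFlow

end

/-! Let `S` commute with the flow, be close to the identity and not be a time map. Ergodicity and
freeness force `S` to move almost every point off its orbit (`exists_ae_eq_vadd`), and this passes
through the isomorphism (`ae_notMem_orbit`). So the property `R(t₀, P)` applies to most pairs `x`,
`S x`: for some `p ∈ P` and most `n` in a long window, `z = T_{n t₀} x` is close to `T_{n t₀ + p} S
x = S T_p z`. Since `S` is nearly the identity, `S T_p z` is usually close to `T_p z`, hence `z` is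
close to `T_p z` along most of the window. By freeness such `z` form a set of small measure, which
is a contradiction (`exists_le_measure_dist`).

The time-`t₀` map need not be ergodic, so the windows `[M, M + L]`, `L ≥ κ M`, are controlled by
estimates valid for every measure-preserving map. The order of choices dictates their form. The set
where `T_p` moves little is fixed before `κ`, so its bound must not depend on `κ`, but it may
require long windows (`exists_measure_window_le`). The set where `S` moves `T_p z` much comes last,
so its bound may depend on `κ` but must hold for windows of every length
(`measure_indicator_window_le`).

The result is a neighborhood of the identity in `C(T)` lying inside the group of time maps (via
`exists_koopman_dist_lt`). The quotient is therefore discrete, and separability of `L²` makes it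
countable. -/

namespace RatnerFlow

/-! ### The maximal ergodic inequality. -/

section Maximal

variable {X : Type*}

/-- The maximum of the Birkhoff sums `∑ k < j, g (T^[k] x)` over `0 ≤ j ≤ n`. -/
noncomputable def birkhoffMax (T : X → X) (g : X → ℝ) : ℕ → X → ℝ
  | 0 => fun _ => 0
  | n + 1 => fun x => max 0 (g x + birkhoffMax T g n (T x))

theorem birkhoffMax_nonneg (T : X → X) (g : X → ℝ) (n : ℕ) (x : X) : 0 ≤ birkhoffMax T g n x := by
  cases n with
  | zero => exact le_rfl
  | succ n => exact le_max_left _ _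

theorem birkhoffMax_le_succ (T : X → X) (g : X → ℝ) (n : ℕ) (x : X) :
    birkhoffMax T g n x ≤ birkhoffMax T g (n + 1) x := by
  induction n generalizing x with
  | zero => exact birkhoffMax_nonneg T g 1 x
  | succ n ih => exact max_le_max le_rfl (add_le_add le_rfl (ih (T x)))

theorem birkhoffSum_le_birkhoffMax (T : X → X) (g : X → ℝ) (n : ℕ) (x : X) :
    birkhoffSum T g n x ≤ birkhoffMax T g n x := by
  induction n generalizing x with
  | zero => simp [birkhoffMax]
  | succ n ih =>
    rw [birkhoffSum_succ']
    exact le_max_of_le_right (add_le_add le_rfl (ih (T x)))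

theorem birkhoffMax_le_of_pos {T : X → X} {g : X → ℝ} {n : ℕ} {x : X}
    (h : 0 < birkhoffMax T g n x) : birkhoffMax T g n x ≤ g x + birkhoffMax T g n (T x) := by
  cases n with
  | zero => exact absurd h (lt_irrefl _)
  | succ n =>
    rcases le_max_iff.1 (le_refl (birkhoffMax T g (n + 1) x)) with h0 | h1
    · exact absurd h (not_lt.2 h0)
    · exact h1.trans (add_le_add le_rfl (birkhoffMax_le_succ T g n (T x)))

variable [MeasurableSpace X] {μ : Measure X}

theorem measurable_birkhoffMax {T : X → X} (hT : Measurable T) {g : X → ℝ} (hg : Measurable g)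
    (n : ℕ) : Measurable (birkhoffMax T g n) := by
  induction n with
  | zero => exact measurable_const
  | succ n ih => exact measurable_const.max (hg.add (ih.comp hT))

theorem integrable_birkhoffMax {T : X → X} (hT : MeasurePreserving T μ μ) {g : X → ℝ}
    (hg : Integrable g μ) (n : ℕ) : Integrable (birkhoffMax T g n) μ := by
  induction n with
  | zero => exact integrable_zero _ _ _
  | succ n ih => exact (integrable_zero _ _ _).sup (hg.add (hT.integrable_comp_of_integrable ih))

/-- Garsia's argument: with `m` the maximum, `m - m ∘ T` has integral zero, is at most `g` where `m
> 0`, and is at most `0` elsewhere. -/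
theorem setIntegral_birkhoffMax_pos_nonneg {T : X → X} (hT : MeasurePreserving T μ μ) {g : X → ℝ}
    (hgm : Measurable g) (hg : Integrable g μ) (n : ℕ) :
    0 ≤ ∫ x in {x | 0 < birkhoffMax T g n x}, g x ∂μ := by
  set m := birkhoffMax T g n with hm
  have hmm : Measurable m := measurable_birkhoffMax hT.measurable hgm n
  have hA : MeasurableSet {x | 0 < m x} := measurableSet_lt measurable_const hmm
  have hmi : Integrable m μ := integrable_birkhoffMax hT hg n
  have hmT : Integrable (fun x => m (T x)) μ := hT.integrable_comp_of_integrable hmi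
  have h1 : ∫ x, (m x - m (T x)) ∂μ = 0 := by
    rw [integral_sub hmi hmT, sub_eq_zero]
    rw [← integral_map (φ := T) hT.measurable.aemeasurable
      (by rw [hT.map_eq]; exact hmm.aestronglyMeasurable), hT.map_eq]
  refine h1.symm.le.trans ?_
  rw [← integral_indicator hA]
  refine integral_mono (hmi.sub hmT) (hg.indicator hA) fun x => ?_
  by_cases hx : 0 < m x
  · have : {x | 0 < m x}.indicator g x = g x := indicator_of_mem (s := {x | 0 < m x}) hx g
    rw [this]
    have := birkhoffMax_le_of_pos hx
    simp only [hm]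
    linarith
  · have : {x | 0 < m x}.indicator g x = 0 := indicator_of_notMem (s := {x | 0 < m x}) hx g
    rw [this]
    have h0 : 0 ≤ m (T x) := birkhoffMax_nonneg T g n (T x)
    linarith

/-- The **maximal ergodic inequality**. -/
theorem measure_exists_lt_birkhoffSum_le [IsFiniteMeasure μ] {T : X → X}
    (hT : MeasurePreserving T μ μ) {g : X → ℝ} (hgm : Measurable g) (hg : Integrable g μ)
    (hg0 : ∀ x, 0 ≤ g x) {c : ℝ} (hc : 0 < c) :
    μ {x | ∃ n : ℕ, n * c < birkhoffSum T g n x} ≤ ENNReal.ofReal ((∫ x, g x ∂μ) / c) := by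
  -- Subtracting `c` turns a Birkhoff sum above `n * c` into a positive one.
  set g' : X → ℝ := fun x => g x - c with hg'
  have hgm' : Measurable g' := hgm.sub_const c
  have hgi' : Integrable g' μ := hg.sub (integrable_const c)
  have hsum : ∀ n x, birkhoffSum T g' n x = birkhoffSum T g n x - n * c := by
    intro n x
    simp [birkhoffSum, hg', Finset.sum_sub_distrib]
  have hsub : {x | ∃ n : ℕ, n * c < birkhoffSum T g n x} ⊆
      ⋃ n : ℕ, {x | 0 < birkhoffMax T g' n x} := by
    rintro x ⟨n, hn⟩
    refine mem_iUnion.2 ⟨n, lt_of_lt_of_le ?_ (birkhoffSum_le_birkhoffMax T g' n x)⟩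
    rw [hsum]
    linarith
  refine (measure_mono hsub).trans ?_
  have hmono : Monotone fun n : ℕ => {x | 0 < birkhoffMax T g' n x} :=
    monotone_nat_of_le_succ fun n x hx => lt_of_lt_of_le hx (birkhoffMax_le_succ T g' n x)
  rw [hmono.measure_iUnion]
  refine iSup_le fun n => ?_
  rw [← ofReal_measureReal]
  refine ENNReal.ofReal_le_ofReal ?_
  rw [le_div_iff₀ hc]
  have h := setIntegral_birkhoffMax_pos_nonneg hT hgm' hgi' n
  rw [integral_sub hg.integrableOn (integrable_const c).integrableOn, setIntegral_const] at h
  have h2 : ∫ x in {x | 0 < birkhoffMax T g' n x}, g x ∂μ ≤ ∫ x, g x ∂μ :=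
    setIntegral_le_integral hg (Eventually.of_forall hg0)
  rw [smul_eq_mul] at h
  linarith

end Maximal

/-! ### The mean ergodic decomposition. -/

section Decomposition

/-- Von Neumann's splitting of a Hilbert space under a contraction: fixed vectors and the closure of
the coboundaries. The transfer vector `h` is taken from a dense set so that it can later be a
bounded function. -/
theorem exists_fixed_add_coboundary_add_small {E : Type*} [NormedAddCommGroup E]
    [InnerProductSpace ℝ E] [CompleteSpace E] (K : E →L[ℝ] E) (hK : ‖K‖ ≤ 1) {D : Set E}
    (hD : Dense D) (f : E) {η : ℝ} (hη : 0 < η) :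
    ∃ u h r : E, K u = u ∧ ‖u‖ ≤ ‖f‖ ∧ h ∈ D ∧ ‖r‖ < η ∧ f = u + (K h - h) + r := by
  set F : Submodule ℝ E := K.eqLocus (1 : E →L[ℝ] E) with hF
  have hker : (Fᗮ : Set E) ⊆ closure (LinearMap.range ((K : E →ₗ[ℝ] E) - 1)) := by
    rw [← Submodule.topologicalClosure_coe, SetLike.coe_subset_coe,
      ← Submodule.orthogonal_orthogonal_eq_closure]
    -- A vector `x` orthogonal to all coboundaries has `⟨K x, x⟩ = ‖x‖²`, and with `‖K x‖ ≤ ‖x‖`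
    -- this forces `K x = x`.
    refine Submodule.orthogonal_le fun x hx ↦ eq_of_norm_le_re_inner_eq_norm_sq (𝕜 := ℝ) ?_ ?_
    · simpa using K.le_of_opNorm_le hK x
    · have : ∀ y, inner ℝ (K y) x = inner ℝ y x := by
        simpa [Submodule.mem_orthogonal, inner_sub_left, sub_eq_zero] using hx
      simp [this]
  have hcl : IsClosed (F : Set E) := isClosed_eq K.continuous (1 : E →L[ℝ] E).continuous
  have : CompleteSpace F := hcl.completeSpace_coe
  have hmem : f - F.starProjection f ∈ closure (LinearMap.range ((K : E →ₗ[ℝ] E) - 1) : Set E) :=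
    hker (F.sub_starProjection_mem_orthogonal f)
  obtain ⟨b, ⟨g, rfl⟩, hb⟩ := Metric.mem_closure_iff.1 hmem (η / 2) (by positivity)
  obtain ⟨h, hhD, hh⟩ := Metric.mem_closure_iff.1 (hD g) (η / 4) (by positivity)
  refine ⟨F.starProjection f, h, f - F.starProjection f - (K h - h), ?_,
    F.norm_starProjection_apply_le f, hhD, ?_, by abel⟩
  · exact F.starProjection_apply_mem f
  · have e1 : f - F.starProjection f - (K h - h) =
        (f - F.starProjection f - (((K : E →ₗ[ℝ] E) - 1) g)) + (K (g - h) - (g - h)) := by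
      simp only [LinearMap.sub_apply, map_sub, ContinuousLinearMap.coe_coe, Module.End.one_apply]
      abel
    rw [dist_eq_norm] at hb hh
    have h3 : ‖K (g - h)‖ ≤ ‖g - h‖ := by simpa using K.le_of_opNorm_le hK (g - h)
    rw [e1]
    calc _ ≤ _ := norm_add_le _ _
      _ ≤ _ := add_le_add le_rfl (norm_sub_le _ _)
      _ < η := by linarith

variable {X : Type*} [MeasurableSpace X] {μ : Measure X}

theorem dense_bounded_Lp :
    Dense {h : Lp ℝ 2 μ | ∃ C : ℝ, ∀ᵐ x ∂μ, |h x| ≤ C} := by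
  refine (Lp.simpleFunc.denseRange (E := ℝ) (p := 2) (μ := μ) (by simp)).mono ?_
  rintro _ ⟨s, rfl⟩
  obtain ⟨C, hC⟩ := (Lp.simpleFunc.toSimpleFunc s).exists_forall_norm_le
  refine ⟨C, ?_⟩
  filter_upwards [Lp.simpleFunc.toSimpleFunc_eq_toFun s] with x hx
  rw [← hx]
  exact hC x

end Decomposition

/-! ### Averages over windows far from the origin. -/

section Windows

theorem sum_Icc_add_coboundary_add (a : ℝ) (h r : ℕ → ℝ) (M L : ℕ) :
    ∑ n ∈ Finset.Icc M (M + L), (a + (h (n + 1) - h n) + r n) =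
      (L + 1) * a + (h (M + L + 1) - h M) + ∑ n ∈ Finset.Icc M (M + L), r n := by
  rw [Finset.sum_add_distrib, Finset.sum_add_distrib]
  congr 2
  · simp [Nat.add_assoc]
  · rw [← Finset.Ico_add_one_right_eq_Icc, Finset.sum_Ico_sub]
    omega

theorem sum_Icc_le_birkhoffSum {X : Type*} {T : X → X} {g : X → ℝ} (hg : ∀ x, 0 ≤ g x)
    (M L : ℕ) (x : X) :
    ∑ n ∈ Finset.Icc M (M + L), g (T^[n] x) ≤ birkhoffSum T g (M + L + 1) x := by
  refine Finset.sum_le_sum_of_subset_of_nonneg ?_ fun _ _ _ => hg _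
  intro n hn
  rw [Finset.mem_Icc] at hn
  rw [Finset.mem_range]
  omega

/-- Because `M ≤ L / κ`, the initial segment that contains the window is only a constant factor
longer than the window; this lets the maximal inequality bound sums over windows. -/
theorem add_mul_le_of_mul_le {κ : ℝ} (hκ : 0 < κ) {M L : ℕ} (hL : 1 ≤ L) (hML : κ * M ≤ L) :
    ((M + L + 1 : ℕ) : ℝ) ≤ (1 / κ + 2) * L := by
  have h1 : (M : ℝ) ≤ 1 / κ * L := by
    rw [one_div, ← div_eq_inv_mul, le_div_iff₀ hκ]
    linarith
  have h2 : (1 : ℝ) ≤ L := by exact_mod_cast hL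
  push_cast
  linarith

variable {X : Type*} [MeasurableSpace X] {μ : Measure X}

theorem integral_norm_le_norm_Lp_two {E : Type*} [NormedAddCommGroup E] [IsProbabilityMeasure μ]
    (f : Lp E 2 μ) : ∫ x, ‖f x‖ ∂μ ≤ ‖f‖ := by
  have hf : AEStronglyMeasurable f μ := (Lp.stronglyMeasurable f).aestronglyMeasurable
  have h1 : ∫ x, ‖f x‖ ∂μ = (eLpNorm f 1 μ).toReal := by
    rw [eLpNorm_one_eq_lintegral_enorm, ← integral_norm_eq_lintegral_enorm hf]
  rw [h1, Lp.norm_def]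
  exact ENNReal.toReal_mono (Lp.eLpNorm_ne_top f)
    (eLpNorm_le_eLpNorm_of_exponent_le (by norm_num) hf)

theorem integrable_Lp_two {E : Type*} [NormedAddCommGroup E] [IsProbabilityMeasure μ]
    (f : Lp E 2 μ) : Integrable f μ :=
  (Lp.memLp f).integrable (by norm_num)

/-- Averages of a function of small `L²` norm over long windows `[M, M + L]` with `L ≥ κ M` are
small, outside a set of small measure. -/
theorem exists_measure_window_le [IsProbabilityMeasure μ] {T : X → X}
    (hT : MeasurePreserving T μ μ) (f : Lp ℝ 2 μ) {κ c η : ℝ} (hκ : 0 < κ) (hc : 0 < c)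
    (hη : 0 < η) :
    ∃ N : ℕ, μ {x | ∃ M L : ℕ, N ≤ L ∧ 1 ≤ L ∧ κ * M ≤ L ∧
      c * L < ∑ n ∈ Finset.Icc M (M + L), f (T^[n] x)} ≤ ENNReal.ofReal (4 / c * ‖f‖ + η) := by
  -- The maximal threshold for `r`: sums over `M + L + 1 ≤ (1 / κ + 2) L` terms then stay below `c L
  -- / 4`. Taking `‖r‖ < η l` absorbs the whole dependence on `κ`.
  set l : ℝ := c / (4 * (1 / κ + 2)) with hl
  have hl0 : 0 < l := by positivity
  obtain ⟨u, h, r, hu, hun, ⟨C, hC⟩, hr, hf⟩ := exists_fixed_add_coboundary_add_small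
    (Lp.compMeasurePreservingₗᵢ ℝ T hT : Lp ℝ 2 μ →ₗᵢ[ℝ] Lp ℝ 2 μ).toContinuousLinearMap
    (LinearIsometry.norm_toContinuousLinearMap_le _) (dense_bounded_Lp (μ := μ)) f
    (mul_pos hη hl0)
  -- The coboundary telescopes to at most `2 C`, which is below `c L / 4` once `L ≥ 8 C / c`.
  obtain ⟨N, hN⟩ := exists_nat_ge (8 * C / c)
  refine ⟨N, ?_⟩
  have hK : ∀ g : Lp ℝ 2 μ,
      ((Lp.compMeasurePreservingₗᵢ ℝ T hT : Lp ℝ 2 μ →ₗᵢ[ℝ] Lp ℝ 2 μ).toContinuousLinearMap g :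
        X → ℝ) =ᵐ[μ] g ∘ T := fun g => Lp.coeFn_compMeasurePreserving g hT
  have hu' : ∀ᵐ x ∂μ, u (T x) = u x := by
    have := hK u
    rw [hu] at this
    filter_upwards [this] with x hx using hx.symm
  have hf' : ∀ᵐ x ∂μ, f x = u x + (h (T x) - h x) + r x := by
    rw [hf]
    filter_upwards [Lp.coeFn_add (u + ((Lp.compMeasurePreservingₗᵢ ℝ T hT :
        Lp ℝ 2 μ →ₗᵢ[ℝ] Lp ℝ 2 μ).toContinuousLinearMap h - h)) r,
      Lp.coeFn_add u ((Lp.compMeasurePreservingₗᵢ ℝ T hT :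
        Lp ℝ 2 μ →ₗᵢ[ℝ] Lp ℝ 2 μ).toContinuousLinearMap h - h),
      Lp.coeFn_sub ((Lp.compMeasurePreservingₗᵢ ℝ T hT :
        Lp ℝ 2 μ →ₗᵢ[ℝ] Lp ℝ 2 μ).toContinuousLinearMap h) h, hK h] with x h1 h2 h3 h4
    rw [h1, Pi.add_apply, h2, Pi.add_apply, h3, Pi.sub_apply, h4, Function.comp_apply]
  have hall : ∀ᵐ x ∂μ, ∀ n, (u (T (T^[n] x)) = u (T^[n] x) ∧
      f (T^[n] x) = u (T^[n] x) + (h (T (T^[n] x)) - h (T^[n] x)) + r (T^[n] x) ∧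
      |h (T^[n] x)| ≤ C) :=
    ae_all_iff.2 fun n => (hT.iterate n).quasiMeasurePreserving.ae (hu'.and (hf'.and hC))
  have hsub : {x | ∃ M L : ℕ, N ≤ L ∧ 1 ≤ L ∧ κ * M ≤ L ∧
      c * L < ∑ n ∈ Finset.Icc M (M + L), f (T^[n] x)} ≤ᵐ[μ]
      ({x | c / 4 ≤ |u x|} ∪ {x | ∃ n : ℕ, n * l < birkhoffSum T (fun x => |r x|) n x} : Set X) := by
    filter_upwards [hall] with x hx
    rintro ⟨M, L, hNL, hL, hML, hlt⟩
    by_contra hcon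
    have hcon : ¬ (c / 4 ≤ |u x| ∨ ∃ n : ℕ, n * l < birkhoffSum T (fun x => |r x|) n x) := hcon
    push Not at hcon
    obtain ⟨hc1, hc2⟩ := hcon
    have hux : ∀ n, u (T^[n] x) = u x := by
      intro n
      induction n with
      | zero => rfl
      | succ n ih => rw [Function.iterate_succ_apply', (hx n).1, ih]
    have hsum : ∑ n ∈ Finset.Icc M (M + L), f (T^[n] x) = _ :=
      (Finset.sum_congr rfl fun n _ => by
        rw [(hx n).2.1, hux, ← Function.iterate_succ_apply' T n x]).trans
      (sum_Icc_add_coboundary_add (u x) (fun n => h (T^[n] x)) (fun n => r (T^[n] x)) M L)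
    have hL1 : (1 : ℝ) ≤ L := by exact_mod_cast hL
    have hNL' : (N : ℝ) ≤ L := by exact_mod_cast hNL
    -- The window has `L + 1 ≤ 2 L` terms, so the threshold `c / 4` for `u` costs `c L / 2`.
    have b1 : ((L : ℝ) + 1) * u x ≤ c * L / 2 := by
      have : u x ≤ c / 4 := (le_abs_self _).trans hc1.le
      nlinarith
    have b2 : h (T^[M + L + 1] x) - h (T^[M] x) ≤ c * L / 4 := by
      have h1 := (abs_le.1 (hx (M + L + 1)).2.2).2
      have h2 := (abs_le.1 (hx M).2.2).1
      have h3 : 8 * C ≤ L * c := (div_le_iff₀ hc).1 (hN.trans hNL')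
      linarith
    have b3 : ∑ n ∈ Finset.Icc M (M + L), r (T^[n] x) ≤ c * L / 4 := by
      calc ∑ n ∈ Finset.Icc M (M + L), r (T^[n] x)
          ≤ ∑ n ∈ Finset.Icc M (M + L), |r (T^[n] x)| :=
            Finset.sum_le_sum fun _ _ => le_abs_self _
        _ ≤ _ := sum_Icc_le_birkhoffSum (g := fun x => |r x|) (fun _ => abs_nonneg _) M L x
        _ ≤ ((M + L + 1 : ℕ) : ℝ) * l := hc2 _
        _ ≤ ((1 / κ + 2) * L) * l :=
            mul_le_mul_of_nonneg_right (add_mul_le_of_mul_le hκ hL hML) hl0.le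
        _ = c * L / 4 := by
            rw [hl]
            field_simp
    rw [hsum] at hlt
    linarith
  refine (measure_mono_ae hsub).trans ((measure_union_le _ _).trans ?_)
  rw [ENNReal.ofReal_add (by positivity) hη.le]
  refine add_le_add ?_ ?_
  · rw [← ofReal_measureReal]
    refine ENNReal.ofReal_le_ofReal ?_
    have h1 := mul_meas_ge_le_integral_of_nonneg (μ := μ) (f := fun x => |u x|)
      (Eventually.of_forall fun _ => abs_nonneg _) (integrable_Lp_two u).abs (c / 4)
    have h2 : ∫ x, |u x| ∂μ ≤ ‖u‖ := integral_norm_le_norm_Lp_two u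
    have h3 : μ.real {x | c / 4 ≤ |u x|} ≤ ‖f‖ / (c / 4) := by
      rw [le_div_iff₀ (by positivity)]
      linarith
    refine h3.trans (le_of_eq ?_)
    field_simp
  · refine (measure_exists_lt_birkhoffSum_le hT (Lp.stronglyMeasurable r).measurable.abs
      (integrable_Lp_two r).abs (fun _ => abs_nonneg _) hl0).trans (ENNReal.ofReal_le_ofReal ?_)
    rw [div_le_iff₀ hl0]
    exact (integral_norm_le_norm_Lp_two r).trans hr.le

theorem exists_measure_indicator_window_le [IsProbabilityMeasure μ] {T : X → X}
    (hT : MeasurePreserving T μ μ) {s : Set X} (hs : MeasurableSet s) {κ c η : ℝ} (hκ : 0 < κ)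
    (hc : 0 < c) (hη : 0 < η) :
    ∃ N : ℕ, μ {x | ∃ M L : ℕ, N ≤ L ∧ 1 ≤ L ∧ κ * M ≤ L ∧
      c * L < ∑ n ∈ Finset.Icc M (M + L), s.indicator (fun _ => (1 : ℝ)) (T^[n] x)} ≤
        ENNReal.ofReal (4 / c * √(μ.real s) + η) := by
  obtain ⟨N, hN⟩ := exists_measure_window_le hT
    (indicatorConstLp 2 hs (measure_ne_top μ s) (1 : ℝ)) hκ hc hη
  refine ⟨N, ?_⟩
  have hnorm : ‖indicatorConstLp 2 hs (measure_ne_top μ s) (1 : ℝ)‖ = √(μ.real s) := by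
    rw [norm_indicatorConstLp (by norm_num) (by norm_num), Real.sqrt_eq_rpow]
    simp
  rw [hnorm] at hN
  refine le_trans (measure_mono_ae ?_) hN
  have hall : ∀ᵐ x ∂μ, ∀ n, indicatorConstLp 2 hs (measure_ne_top μ s) (1 : ℝ) (T^[n] x) =
      s.indicator (fun _ => (1 : ℝ)) (T^[n] x) :=
    ae_all_iff.2 fun n => (hT.iterate n).quasiMeasurePreserving.ae
      (indicatorConstLp_coeFn (p := 2) (hs := hs) (hμs := measure_ne_top μ s) (c := (1 : ℝ)))
  filter_upwards [hall] with x hx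
  rintro ⟨M, L, h1, h2, h3, h4⟩
  refine ⟨M, L, h1, h2, h3, ?_⟩
  simpa only [hx] using h4

/-- A bound on window averages of an indicator function that is linear in the measure of the set and
holds for windows of every length. -/
theorem measure_indicator_window_le [IsProbabilityMeasure μ] {T : X → X}
    (hT : MeasurePreserving T μ μ) {s : Set X} (hs : MeasurableSet s) {κ c : ℝ} (hκ : 0 < κ)
    (hc : 0 < c) :
    μ {x | ∃ M L : ℕ, 1 ≤ L ∧ κ * M ≤ L ∧
      c * L < ∑ n ∈ Finset.Icc M (M + L), s.indicator (fun _ => (1 : ℝ)) (T^[n] x)} ≤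
        ENNReal.ofReal ((1 / κ + 2) / c * μ.real s) := by
  have hl0 : 0 < c / (1 / κ + 2) := by positivity
  have h0 : ∀ x, 0 ≤ s.indicator (fun _ => (1 : ℝ)) x :=
    fun x => indicator_nonneg (fun _ _ => zero_le_one) x
  have key := measure_exists_lt_birkhoffSum_le hT (g := s.indicator fun _ => (1 : ℝ))
    (measurable_const.indicator hs) ((integrable_const 1).indicator hs) h0 hl0
  rw [integral_indicator_const _ hs, smul_eq_mul, mul_one] at key
  have e : μ.real s / (c / (1 / κ + 2)) = (1 / κ + 2) / c * μ.real s := by field_simp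
  rw [e] at key
  refine le_trans (measure_mono ?_) key
  rintro x ⟨M, L, hL, hML, hlt⟩
  refine ⟨M + L + 1, lt_of_le_of_lt ?_ (hlt.trans_le (sum_Icc_le_birkhoffSum h0 M L x))⟩
  calc _ ≤ ((1 / κ + 2) * L) * (c / (1 / κ + 2)) :=
        mul_le_mul_of_nonneg_right (add_mul_le_of_mul_le hκ hL hML) hl0.le
    _ = c * L := by field_simp

end Windows

/-! ### Commuting maps and orbits. -/

section Orbits

variable {X : Type u} [MeasurableSpace X] [StandardBorelSpace X] [AddAction ℝ X]
  [MeasurableVAdd₂ ℝ X] {μ : Measure X}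

/-- A map that commutes with a free ergodic flow and moves a non-null set of points along their
orbits is a time-`c` map of the flow. -/
theorem exists_ae_eq_vadd [ErgodicVAdd ℝ X μ] (hfree : IsFree μ) {e : X → X} (he : Measurable e)
    (hcomm : ∀ t : ℝ, ∀ᵐ x ∂μ, e (t +ᵥ x) = t +ᵥ e x)
    (hne : ¬ ∀ᵐ x ∂μ, ∀ t : ℝ, e x ≠ t +ᵥ x) : ∃ c : ℝ, ∀ᵐ x ∂μ, e x = c +ᵥ x := by
  classical
  obtain ⟨X₀, hX₀free, hX₀m, hX₀⟩ := exists_measurable_superset_of_null hfree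
  replace hX₀ : ∀ᵐ x ∂μ, x ∈ X₀ᶜ := measure_eq_zero_iff_ae_notMem.1 hX₀
  have hfree₀ : ∀ x ∈ X₀ᶜ, ∀ s t : ℝ, s +ᵥ x = t +ᵥ x → s = t := by
    intro x hx s t hst
    by_contra hne
    refine hx (hX₀free fun h => h (-t + s) (fun h0 => hne (by linarith)) ?_)
    rw [add_vadd, hst, neg_vadd_vadd]
  -- The points displaced along their orbit by a time in `U`. Freeness makes the projection below
  -- injective, hence `D U` Borel; commutation with the flow makes it invariant, so ergodicity makes
  -- it null or conull.
  let D : Set ℝ → Set X := fun U => {x | x ∈ X₀ᶜ ∧ ∃ t ∈ U, e x = t +ᵥ x}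
  have hDm : ∀ U, MeasurableSet U → MeasurableSet (D U) := by
    intro U hU
    have hG : MeasurableSet {p : X × ℝ | p.1 ∈ X₀ᶜ ∧ p.2 ∈ U ∧ e p.1 = p.2 +ᵥ p.1} := by
      refine (measurable_fst hX₀m.compl).inter ((measurable_snd hU).inter ?_)
      exact measurableSet_eq_fun (he.comp measurable_fst) (measurable_snd.vadd measurable_fst)
    have := hG.image_of_measurable_injOn measurable_fst (by
      rintro ⟨x, s⟩ ⟨hx, -, hs⟩ ⟨y, t⟩ ⟨-, -, ht⟩ (rfl : x = y)
      exact Prod.ext rfl (hfree₀ x hx s t (hs.symm.trans ht)))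
    convert this using 1
    ext x
    constructor
    · rintro ⟨hx, t, htU, ht⟩
      exact ⟨(x, t), ⟨hx, htU, ht⟩, rfl⟩
    · rintro ⟨⟨y, t⟩, ⟨hx, htU, ht⟩, rfl⟩
      exact ⟨hx, t, htU, ht⟩
  have hDc : ∀ U, MeasurableSet U → (∀ᵐ x ∂μ, x ∈ D U) ∨ ∀ᵐ x ∂μ, x ∉ D U := by
    intro U hU
    have hinv : ∀ g : ℝ, (g +ᵥ ·) ⁻¹' D U =ᵐ[μ] D U := by
      intro g
      have hg : ∀ᵐ x ∂μ, g +ᵥ x ∈ X₀ᶜ :=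
        (measurePreserving_vadd g μ).quasiMeasurePreserving.ae hX₀
      filter_upwards [hg, hX₀, hcomm g] with x h1 h2 h3
      refine propext ⟨?_, ?_⟩
      · rintro ⟨-, t, htU, ht⟩
        refine ⟨h2, t, htU, ?_⟩
        have ht : e (g +ᵥ x) = t +ᵥ (g +ᵥ x) := ht
        rw [h3, vadd_comm t g] at ht
        exact AddAction.injective g ht
      · rintro ⟨-, t, htU, ht⟩
        refine ⟨h1, t, htU, ?_⟩
        show e (g +ᵥ x) = t +ᵥ (g +ᵥ x)
        rw [h3, ht, vadd_comm]
    exact eventuallyConst_set.1 (ErgodicVAdd.aeconst_of_forall_preimage_vadd_ae_eq (hDm U hU) hinv)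
  have hD : ∀ᵐ x ∂μ, x ∈ D univ := by
    refine (hDc univ MeasurableSet.univ).resolve_right fun h => hne ?_
    filter_upwards [h, hX₀] with x hx hx0 t ht
    exact hx ⟨hx0, t, mem_univ t, ht⟩
  let τ : X → ℝ := fun x => if h : ∃ t : ℝ, e x = t +ᵥ x then h.choose else 0
  have hτ : ∀ x ∈ D univ, e x = τ x +ᵥ x := by
    rintro x ⟨-, t, -, ht⟩
    have h : ∃ t : ℝ, e x = t +ᵥ x := ⟨t, ht⟩
    simp only [τ, dif_pos h]
    exact h.choose_spec
  have hτU : ∀ U, ∀ x ∈ D univ, (τ x ∈ U ↔ x ∈ D U) := by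
    intro U x hx
    refine ⟨fun h => ⟨hx.1, τ x, h, hτ x hx⟩, ?_⟩
    rintro ⟨hx0, t, htU, ht⟩
    rwa [hfree₀ x hx0 (τ x) t ((hτ x hx).symm.trans ht)]
  -- A displacement that lies in each Borel set almost surely or almost never is almost surely
  -- constant.
  obtain ⟨c, hc⟩ : ∃ c, τ =ᵐ[μ] fun _ => c := by
    refine exists_eventuallyEq_const_of_forall_separating MeasurableSet fun U hU => ?_
    rcases hDc U hU with h | h
    · left
      filter_upwards [h, hD] with x h1 h2
      exact (hτU U x h2).2 h1
    · right
      filter_upwards [h, hD] with x h1 h2 h3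
      exact h1 ((hτU U x h2).1 h3)
  refine ⟨c, ?_⟩
  filter_upwards [hc, hD] with x h1 h2
  rw [← h1, ← hτ x h2]

variable {Y : Type v} [MetricSpace Y] [SecondCountableTopology Y] [MeasurableSpace Y]
  [BorelSpace Y] [AddAction ℝ Y] [MeasurableVAdd₂ ℝ Y] {φ : X → Y} {ψ : Y → X}

/-- Fubini exchanges the quantifiers: the exceptional null set for each `t` becomes a null set of
times for almost every `x`. -/
theorem ae_ae_intertwine [SFinite μ] [VAddInvariantMeasure ℝ X μ] (hφ : Measurable φ)
    (hψ : Measurable ψ) (hψφ : ∀ᵐ x ∂μ, ψ (φ x) = x)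
    (hφT : ∀ t : ℝ, ∀ᵐ x ∂μ, φ (t +ᵥ x) = t +ᵥ φ x) :
    ∀ᵐ x ∂μ, ∀ᵐ t : ℝ, φ (t +ᵥ x) = t +ᵥ φ x ∧ ψ (φ (t +ᵥ x)) = t +ᵥ x := by
  have hm : Measurable fun p : X × ℝ => p.2 +ᵥ p.1 := measurable_snd.vadd measurable_fst
  refine (Measure.ae_ae_comm ?_).2 (Eventually.of_forall fun t => ?_)
  · refine MeasurableSet.inter ?_ ?_
    · exact measurableSet_eq_fun (hφ.comp hm) (measurable_snd.vadd (hφ.comp measurable_fst))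
    · exact measurableSet_eq_fun (hψ.comp (hφ.comp hm)) hm
  · exact (hφT t).and ((measurePreserving_vadd t μ).quasiMeasurePreserving.ae hψφ)

/-- An isomorphism of flows maps points in different orbits to points in different orbits. -/
theorem ae_notMem_orbit [SFinite μ] [VAddInvariantMeasure ℝ X μ] (hφ : Measurable φ)
    (hψ : Measurable ψ) (hψφ : ∀ᵐ x ∂μ, ψ (φ x) = x)
    (hφT : ∀ t : ℝ, ∀ᵐ x ∂μ, φ (t +ᵥ x) = t +ᵥ φ x) {e : X → X} (he : MeasurePreserving e μ μ)
    (hne : ∀ᵐ x ∂μ, ∀ t : ℝ, e x ≠ t +ᵥ x) :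
    ∀ᵐ x ∂μ, φ x ∉ AddAction.orbit ℝ (φ (e x)) := by
  have h := ae_ae_intertwine hφ hψ hψφ hφT
  filter_upwards [hne, h, he.quasiMeasurePreserving.ae h] with x h1 h2 h3
  rintro ⟨s, hs⟩
  have hs : s +ᵥ φ (e x) = φ x := hs
  -- The time `s` depends on `x`, so intertwining at `s` itself is unavailable; instead take `t`
  -- good for `x` with `t + s` good for `e x`.
  obtain ⟨t, ⟨h4, h5⟩, h6, h7⟩ :=
    (h2.and ((measurePreserving_add_right volume s).quasiMeasurePreserving.ae h3)).exists
  have h8 : φ (t +ᵥ x) = φ ((t + s) +ᵥ e x) := by rw [h4, h6, add_vadd, hs]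
  have h9 : t +ᵥ x = (t + s) +ᵥ e x := by rw [← h5, h8, h7]
  rw [add_vadd] at h9
  refine h1 (-s) ?_
  have h10 : x = s +ᵥ e x := AddAction.injective t h9
  conv_rhs => rw [h10, neg_vadd_vadd]

end Orbits

/-! ### Commuting maps that preserve no orbit stay away from the identity. -/

section Gap

theorem iterate_vadd {X : Type*} [AddAction ℝ X] (t : ℝ) (n : ℕ) (x : X) :
    (fun z : X => t +ᵥ z)^[n] x = (n * t : ℝ) +ᵥ x := by
  induction n with
  | zero => simp
  | succ n ih =>
    rw [Function.iterate_succ_apply', ih, vadd_vadd]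
    push_cast
    congr 1
    ring

/-- A shadowing window of `R(t₀, P)` for `x` and `e x` forces many visits of the orbit of `x` to
points that `T_p` moves little or to points that `e ∘ T_p` and `T_p` separate. -/
theorem card_window_le {X Y : Type*} [AddAction ℝ X] [PseudoMetricSpace Y] [AddAction ℝ Y]
    {φ : X → Y} {t₀ ε p : ℝ} {e : X → X} {x : X} (M L : ℕ)
    (h1 : ∀ n : ℕ, φ ((n * t₀ : ℝ) +ᵥ x) = (n * t₀ : ℝ) +ᵥ φ x)
    (h2 : ∀ n : ℕ, φ (e ((n * t₀ + p : ℝ) +ᵥ x)) = (n * t₀ + p : ℝ) +ᵥ φ (e x)) :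
    (((Finset.Icc M (M + L)).filter fun n : ℕ =>
        dist (((n : ℝ) * t₀) +ᵥ φ x) (((n : ℝ) * t₀ + p) +ᵥ φ (e x)) < ε).card : ℝ) ≤
      (∑ n ∈ Finset.Icc M (M + L), {z : X | dist (φ z) (φ (p +ᵥ z)) < 2 * ε}.indicator
        (fun _ => (1 : ℝ)) ((fun z : X => t₀ +ᵥ z)^[n] x)) +
      ∑ n ∈ Finset.Icc M (M + L), {z : X | ε ≤ dist (φ (p +ᵥ z)) (φ (e (p +ᵥ z)))}.indicator
        (fun _ => (1 : ℝ)) ((fun z : X => t₀ +ᵥ z)^[n] x) := by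
  rw [Finset.card_filter, ← Finset.sum_add_distrib]
  push_cast
  refine Finset.sum_le_sum fun n _ => ?_
  have n1 : ∀ s : Set X, ∀ z, 0 ≤ s.indicator (fun _ => (1 : ℝ)) z := fun s z =>
    indicator_nonneg (fun _ _ => zero_le_one) z
  split_ifs with h
  · rw [iterate_vadd]
    set z : X := (n * t₀ : ℝ) +ᵥ x with hz
    rw [← h1, ← h2, add_comm (n * t₀) p, add_vadd, ← hz] at h
    by_cases hs : ε ≤ dist (φ (p +ᵥ z)) (φ (e (p +ᵥ z)))
    · have : {z : X | ε ≤ dist (φ (p +ᵥ z)) (φ (e (p +ᵥ z)))}.indicator (fun _ => (1 : ℝ)) z = 1 :=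
        indicator_of_mem (s := {z : X | ε ≤ dist (φ (p +ᵥ z)) (φ (e (p +ᵥ z)))}) hs _
      rw [this]
      exact le_add_of_nonneg_left (n1 _ z)
    · have hF : dist (φ z) (φ (p +ᵥ z)) < 2 * ε := by
        have := dist_triangle_right (φ z) (φ (p +ᵥ z)) (φ (e (p +ᵥ z)))
        push Not at hs
        linarith
      have : {z : X | dist (φ z) (φ (p +ᵥ z)) < 2 * ε}.indicator (fun _ => (1 : ℝ)) z = 1 :=
        indicator_of_mem (s := {z : X | dist (φ z) (φ (p +ᵥ z)) < 2 * ε}) hF _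
      rw [this]
      exact le_add_of_nonneg_right (n1 _ z)
  · exact add_nonneg (n1 _ _) (n1 _ _)

/-- As `ε` decreases to `0` the sets shrink to the points with `φ x = φ (p +ᵥ x)`, a null set by
freeness and almost sure injectivity of `φ`; finiteness of `P` makes `ε` uniform. -/
theorem exists_measure_dist_vadd_lt {X : Type u} [MeasurableSpace X] [AddAction ℝ X]
    [MeasurableVAdd₂ ℝ X] {μ : Measure X} {Y : Type v} [MetricSpace Y] [SecondCountableTopology Y]
    [MeasurableSpace Y] [BorelSpace Y] {φ : X → Y} {ψ : Y → X} [IsFiniteMeasure μ]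
    (hφ : Measurable φ)
    (hψφ : ∀ᵐ x ∂μ, ψ (φ x) = x) [VAddInvariantMeasure ℝ X μ] (hfree : IsFree μ) {P : Finset ℝ}
    (hP : (0 : ℝ) ∉ P) {ρ ε₀ : ℝ} (hρ : 0 < ρ) (hε₀ : 0 < ε₀) :
    ∃ ε, 0 < ε ∧ ε ≤ ε₀ ∧ ∀ p ∈ P, μ.real {x | dist (φ x) (φ (p +ᵥ x)) < ε} < ρ := by
  have hm : ∀ (p : ℝ), Measurable fun x => dist (φ x) (φ (p +ᵥ x)) := fun p =>
    hφ.dist (hφ.comp (measurable_const_vadd p))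
  have hlim : ∀ p ∈ P, Tendsto (fun k : ℕ =>
      μ {x | dist (φ x) (φ (p +ᵥ x)) < ε₀ / (k + 1)}) atTop (𝓝 0) := by
    intro p hp
    have h := tendsto_measure_iInter_atTop (μ := μ)
      (s := fun k : ℕ => {x | dist (φ x) (φ (p +ᵥ x)) < ε₀ / (k + 1)})
      (fun k => (measurableSet_lt (hm p) measurable_const).nullMeasurableSet)
      (fun i j hij x hx => lt_of_lt_of_le hx (by
        have : (i : ℝ) ≤ j := by exact_mod_cast hij
        show ε₀ / ((j : ℝ) + 1) ≤ ε₀ / ((i : ℝ) + 1)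
        gcongr))
      ⟨0, measure_ne_top _ _⟩
    suffices h0 : μ (⋂ k : ℕ, {x | dist (φ x) (φ (p +ᵥ x)) < ε₀ / (k + 1)}) = 0 by
      rw [h0] at h
      exact h
    rw [measure_eq_zero_iff_ae_notMem]
    filter_upwards [hψφ, (measurePreserving_vadd p μ).quasiMeasurePreserving.ae hψφ, hfree]
      with x h1 h2 h3 hx
    have hpos : 0 < dist (φ x) (φ (p +ᵥ x)) := by
      refine dist_pos.2 fun h => h3 p (fun h0 => hP (h0 ▸ hp)) ?_
      rw [← h2, ← h, h1]
    obtain ⟨k, hk⟩ := exists_nat_gt (ε₀ / dist (φ x) (φ (p +ᵥ x)))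
    have hxk : dist (φ x) (φ (p +ᵥ x)) < ε₀ / (k + 1) := mem_iInter.1 hx k
    rw [div_lt_iff₀ hpos] at hk
    rw [lt_div_iff₀ (by positivity)] at hxk
    nlinarith
  have hev : ∀ᶠ k : ℕ in atTop, ∀ p ∈ P,
      μ.real {x | dist (φ x) (φ (p +ᵥ x)) < ε₀ / (k + 1)} < ρ := by
    rw [eventually_all_finset]
    intro p hp
    have := (ENNReal.tendsto_toReal ENNReal.zero_ne_top).comp (hlim p hp)
    exact this.eventually (gt_mem_nhds (by simpa using hρ))
  obtain ⟨k, hk⟩ := hev.exists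
  exact ⟨ε₀ / (k + 1), by positivity, div_le_self hε₀.le (by linarith [k.cast_nonneg (α := ℝ)]), hk⟩

variable {X : Type u} [MeasurableSpace X] [StandardBorelSpace X] [AddAction ℝ X]
  [MeasurableVAdd₂ ℝ X] {μ : Measure X}
  {Y : Type v} [MetricSpace Y] [SecondCountableTopology Y] [MeasurableSpace Y]
  [BorelSpace Y] [AddAction ℝ Y] [MeasurableVAdd₂ ℝ Y] {φ : X → Y} {ψ : Y → X}

/-- If a flow isomorphic to `(X, μ)` has the property `R(t₀, P)`, then the automorphisms that
commute with the flow and preserve no orbit are uniformly far from the identity. -/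
theorem exists_le_measure_dist [IsProbabilityMeasure μ] [VAddInvariantMeasure ℝ X μ]
    (hfree : IsFree μ) {ν : Measure Y} [IsProbabilityMeasure ν] (hφ : MeasurePreserving φ μ ν)
    (hψ : Measurable ψ) (hψφ : ∀ᵐ x ∂μ, ψ (φ x) = x)
    (hφT : ∀ t : ℝ, ∀ᵐ x ∂μ, φ (t +ᵥ x) = t +ᵥ φ x) {t₀ : ℝ} {P : Finset ℝ}
    (hP : (0 : ℝ) ∉ P) (hR : PropertyR ν t₀ P) :
    ∃ δ : ℝ, 0 < δ ∧ ∃ η : ℝ, 0 < η ∧ ∀ e : X → X, MeasurePreserving e μ μ →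
      (∀ t : ℝ, ∀ᵐ x ∂μ, e (t +ᵥ x) = t +ᵥ e x) → (∀ᵐ x ∂μ, ∀ t : ℝ, e x ≠ t +ᵥ x) →
      η ≤ μ.real {x | δ ≤ dist (φ x) (φ (e x))} := by
  set T : X → X := fun z => t₀ +ᵥ z with hTdef
  have hT : MeasurePreserving T μ μ := measurePreserving_vadd t₀ μ
  have hφm := hφ.measurable
  set q : ℝ := (P.card : ℝ) + 1 with hq
  have hq0 : 0 < q := by positivity
  -- The window bound with `c = 1 / 4` is `16 √ρ + 1 / (8 q)`, which this `ρ` makes at most `1 / (4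
  -- q)`; the sum over `P` is then at most `1 / 4`.
  obtain ⟨ε', hε', hε'8, hF⟩ := exists_measure_dist_vadd_lt hφm hψφ hfree hP
    (ρ := (1 / (128 * q)) ^ 2) (ε₀ := 1 / 4) (by positivity) (by norm_num)
  set ε := ε' / 2 with hε
  have hε0 : 0 < ε := by positivity
  have h2ε : 2 * ε = ε' := by rw [hε]; ring
  rw [← h2ε] at hF
  set F : ℝ → Set X := fun p => {z : X | dist (φ z) (φ (p +ᵥ z)) < 2 * ε} with hFdef
  have hFm : ∀ p, MeasurableSet (F p) := fun p =>
    measurableSet_lt (hφm.dist (hφm.comp (measurable_const_vadd p))) measurable_const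
  obtain ⟨κ, hκ, hR⟩ := hR ε hε0
  have hwin := fun p => exists_measure_indicator_window_le hT (hFm p) hκ
    (c := 1 / 4) (η := 1 / (8 * q)) (by norm_num) (by positivity)
  choose Np hNp using hwin
  -- The `+ 1` keeps `M` and `L` positive, so that both divisions can be cleared.
  obtain ⟨δ, hδ, Z, hZm, hZ, hR⟩ := hR (P.sup Np + 1)
  refine ⟨min δ ε, lt_min hδ hε0, min (1 / 8) (1 / (16 * q * (1 / κ + 2))), by positivity, ?_⟩
  intro e he hcomm hne
  by_contra! hlt
  obtain ⟨hlt8, hltq⟩ := lt_min_iff.1 hlt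
  set B : Set X := {x | min δ ε ≤ dist (φ x) (φ (e x))} with hB
  set E : ℝ → Set X := fun p => {z : X | ε ≤ dist (φ (p +ᵥ z)) (φ (e (p +ᵥ z)))} with hEdef
  have hdm : Measurable fun z => dist (φ z) (φ (e z)) := hφm.dist (hφm.comp he.measurable)
  have hEm : ∀ p, MeasurableSet (E p) := fun p =>
    measurableSet_le measurable_const (hdm.comp (measurable_const_vadd p))
  have hEB : ∀ p, μ.real (E p) ≤ μ.real B := by
    intro p
    have h1 : μ.real (E p) = μ.real {z : X | ε ≤ dist (φ z) (φ (e z))} := by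
      have := (measurePreserving_vadd p μ).measure_preimage
        (measurableSet_le measurable_const hdm : MeasurableSet {z : X | ε ≤ dist (φ z) (φ (e z))}
          ).nullMeasurableSet
      rw [measureReal_def, measureReal_def, ← this]
      rfl
    rw [h1]
    exact measureReal_mono fun z (hz : ε ≤ _) => (min_le_right δ ε).trans hz
  set W₁ : ℝ → Set X := fun p => {x | ∃ M L : ℕ, Np p ≤ L ∧ 1 ≤ L ∧ κ * M ≤ L ∧
      1 / 4 * L < ∑ n ∈ Finset.Icc M (M + L), (F p).indicator (fun _ => (1 : ℝ)) (T^[n] x)} with hW₁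
  set W₂ : ℝ → Set X := fun p => {x | ∃ M L : ℕ, 1 ≤ L ∧ κ * M ≤ L ∧
      1 / 4 * L < ∑ n ∈ Finset.Icc M (M + L), (E p).indicator (fun _ => (1 : ℝ)) (T^[n] x)} with hW₂
  have hW₁m : ∀ p ∈ P, μ.real (W₁ p) ≤ 1 / (4 * q) := by
    intro p hp
    refine (ENNReal.toReal_le_of_le_ofReal (by positivity) (hNp p)).trans ?_
    have hs : √(μ.real (F p)) ≤ 1 / (128 * q) := Real.sqrt_le_iff.2 ⟨by positivity, (hF p hp).le⟩
    have e1 : 16 * (1 / (128 * q)) + 1 / (8 * q) = 1 / (4 * q) := by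
      field_simp
      norm_num
    rw [← e1]
    norm_num at hs ⊢
    linarith
  have hW₂m : ∀ p ∈ P, μ.real (W₂ p) ≤ 1 / (4 * q) := by
    intro p hp
    refine (ENNReal.toReal_le_of_le_ofReal (by positivity)
      (measure_indicator_window_le hT (hEm p) hκ (c := 1 / 4) (by norm_num))).trans ?_
    calc (1 / κ + 2) / (1 / 4) * μ.real (E p)
        ≤ (1 / κ + 2) / (1 / 4) * (1 / (16 * q * (1 / κ + 2))) :=
          mul_le_mul_of_nonneg_left ((hEB p).trans hltq.le) (by positivity)
      _ = 1 / (4 * q) := by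
          field_simp
          norm_num
  have hPq : (P.card : ℝ) * (1 / (4 * q)) ≤ 1 / 4 := by
    rw [mul_one_div, div_le_iff₀ (by positivity), hq]
    linarith
  have hU₁ : μ.real (⋃ p ∈ P, W₁ p) ≤ 1 / 4 := by
    refine (measureReal_biUnion_finset_le P W₁).trans ((Finset.sum_le_sum hW₁m).trans ?_)
    rw [Finset.sum_const, nsmul_eq_mul]
    exact hPq
  have hU₂ : μ.real (⋃ p ∈ P, W₂ p) ≤ 1 / 4 := by
    refine (measureReal_biUnion_finset_le P W₂).trans ((Finset.sum_le_sum hW₂m).trans ?_)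
    rw [Finset.sum_const, nsmul_eq_mul]
    exact hPq
  have hZc : μ.real (φ ⁻¹' Zᶜ) < 1 / 8 := by
    have h1 : μ.real (φ ⁻¹' Zᶜ) = ν.real Zᶜ := by
      rw [measureReal_def, measureReal_def, hφ.measure_preimage hZm.compl.nullMeasurableSet]
    rw [h1, probReal_compl_eq_one_sub hZm]
    linarith
  have hZc' : μ.real (e ⁻¹' (φ ⁻¹' Zᶜ)) < 1 / 8 := by
    rw [measureReal_def, he.measure_preimage (hφm hZm.compl).nullMeasurableSet]
    exact hZc
  -- The covering sets have total measure below `1 / 8 + 1 / 8 + 1 / 8 + 1 / 4 + 1 / 4 < 1`. A point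
  -- outside them would have a shadowing window with more than `(1 - ε) L` hits, but at most `L / 4
  -- + L / 4` are possible and `ε ≤ 1 / 8`.
  have hcover : ∀ᵐ x ∂μ, x ∈ (φ ⁻¹' Zᶜ ∪ e ⁻¹' (φ ⁻¹' Zᶜ)) ∪ B ∪
      ((⋃ p ∈ P, W₁ p) ∪ (⋃ p ∈ P, W₂ p)) := by
    have a1 : ∀ᵐ x ∂μ, ∀ n : ℕ, φ ((n * t₀ : ℝ) +ᵥ x) = (n * t₀ : ℝ) +ᵥ φ x :=
      ae_all_iff.2 fun n => hφT _
    have a2 : ∀ᵐ x ∂μ, ∀ p ∈ P, ∀ n : ℕ,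
        φ (e ((n * t₀ + p : ℝ) +ᵥ x)) = (n * t₀ + p : ℝ) +ᵥ φ (e x) := by
      rw [eventually_all_finset]
      intro p _
      refine ae_all_iff.2 fun n => ?_
      filter_upwards [hcomm (n * t₀ + p), he.quasiMeasurePreserving.ae (hφT (n * t₀ + p))]
        with x h1 h2
      rw [h1, h2]
    filter_upwards [a1, a2, ae_notMem_orbit hφm hψ hψφ hφT he hne] with x h1 h2 h3
    by_contra hx
    simp only [mem_union, mem_preimage, mem_compl_iff, mem_iUnion, not_or, not_not,
      not_exists] at hx
    obtain ⟨⟨⟨hxZ, hexZ⟩, hxB⟩, hx1, hx2⟩ := hx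
    have hxB : dist (φ x) (φ (e x)) < min δ ε := not_le.1 hxB
    obtain ⟨M, L, hM, hL, hML, p, hp, hcard⟩ :=
      hR (φ x) hxZ (φ (e x)) hexZ h3 (hxB.trans_le (min_le_left _ _))
    have hM0 : (0 : ℝ) < M := by exact_mod_cast (by omega : 0 < M)
    have hL1 : 1 ≤ L := by omega
    have hL0 : (0 : ℝ) < L := by exact_mod_cast hL1
    have hML' : κ * M ≤ L := (le_div_iff₀ hM0).1 hML
    have hNL : Np p ≤ L := (Finset.le_sup (f := Np) hp).trans (by omega)
    have b0 := card_window_le (φ := φ) (ε := ε) M L h1 (h2 p hp)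
    have b1 : ∑ n ∈ Finset.Icc M (M + L), (F p).indicator (fun _ => (1 : ℝ)) (T^[n] x) ≤
        1 / 4 * L := not_lt.1 fun h => hx1 p hp ⟨M, L, hNL, hL1, hML', h⟩
    have b2 : ∑ n ∈ Finset.Icc M (M + L), (E p).indicator (fun _ => (1 : ℝ)) (T^[n] x) ≤
        1 / 4 * L := not_lt.1 fun h => hx2 p hp ⟨M, L, hL1, hML', h⟩
    rw [one_div, ← div_eq_inv_mul, lt_div_iff₀ hL0] at hcard
    have hb := hcard.trans_le (b0.trans (add_le_add b1 b2))
    nlinarith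
  have htotal : (1 : ℝ) ≤ _ :=
    (probReal_univ (μ := μ)).symm.le.trans <|
      (measureReal_congr (eventuallyEq_univ.2 hcover)).symm.le.trans <|
      (measureReal_union_le _ _).trans <| add_le_add ((measureReal_union_le _ _).trans <|
        add_le_add (measureReal_union_le _ _) le_rfl) (measureReal_union_le _ _)
  linarith

end Gap

/-! ### The strong topology and quotients of subgroups of `Aut`. -/

section StrongTopology

variable {X : Type u} [MeasurableSpace X] {μ : Measure X}

theorem Aut.koopman_mk (e : mpPerm μ) (f : Lp ℂ 2 μ) :
    (Aut.mk μ e).koopman f = Lp.compMeasurePreserving (fun x => e.1 x) e.2.1 f :=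
  rfl

theorem Aut.mk_surjective : Function.Surjective (Aut.mk μ) :=
  QuotientGroup.mk'_surjective _

theorem Aut.koopman_one (f : Lp ℂ 2 μ) : (1 : Aut μ).koopman f = f := by
  rw [← map_one (Aut.mk μ), Aut.koopman_mk]
  exact Lp.compMeasurePreserving_id_apply f

theorem Aut.koopman_mul (a b : Aut μ) (f : Lp ℂ 2 μ) :
    (a * b).koopman f = b.koopman (a.koopman f) := by
  obtain ⟨a, rfl⟩ := Aut.mk_surjective a
  obtain ⟨b, rfl⟩ := Aut.mk_surjective b
  rw [← map_mul, Aut.koopman_mk, Aut.koopman_mk, Aut.koopman_mk]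
  exact Lp.compMeasurePreserving_comp_apply f a.2.1 b.2.1

theorem Aut.dist_koopman (a : Aut μ) (f g : Lp ℂ 2 μ) :
    dist (a.koopman f) (a.koopman g) = dist f g := by
  obtain ⟨a, rfl⟩ := Aut.mk_surjective a
  exact (Lp.compMeasurePreservingₗᵢ ℂ (fun x => a.1 x) a.2.1).isometry.dist_eq f g

theorem Aut.continuous_koopman_apply (f : Lp ℂ 2 μ) : Continuous fun S : Aut μ => S.koopman f :=
  (continuous_apply f).comp continuous_induced_dom

theorem Aut.dist_koopman_inv_mul (a b : Aut μ) (f : Lp ℂ 2 μ) :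
    dist ((b * a⁻¹).koopman f) f = dist (b.koopman f) (a.koopman f) := by
  have h : a⁻¹.koopman (a.koopman f) = f := by
    rw [← Aut.koopman_mul, mul_inv_cancel, Aut.koopman_one]
  calc dist ((b * a⁻¹).koopman f) f
      = dist (a⁻¹.koopman (b.koopman f)) (a⁻¹.koopman (a.koopman f)) := by rw [Aut.koopman_mul, h]
    _ = dist (b.koopman f) (a.koopman f) := Aut.dist_koopman _ _ _

section Subgroups

variable {C : Subgroup (Aut μ)} {H : Subgroup C} {k : ℕ} {f : Fin k → Lp ℂ 2 μ} {r : ℝ}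

/-- A subgroup containing a neighborhood of the identity has open cosets. -/
theorem discreteTopology_quotient (hr : 0 < r)
    (hH : ∀ S : C, (∀ i, dist (S.1.koopman (f i)) (f i) < r) → S ∈ H) :
    DiscreteTopology (C ⧸ H) := by
  rw [discreteTopology_iff_isOpen_singleton]
  intro q
  refine (QuotientGroup.isQuotientMap_mk (N := H)).isOpen_preimage.1 ?_
  rw [isOpen_iff_mem_nhds]
  intro g hg
  have hg : (g : C ⧸ H) = q := hg
  have hopen : IsOpen {h : C | ∀ i, dist ((g⁻¹ * h).1.koopman (f i)) (f i) < r} := by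
    rw [ofPred_forall]
    refine isOpen_iInter_of_finite fun i => isOpen_lt ?_ continuous_const
    refine Continuous.dist ?_ continuous_const
    have : (fun h : C => (g⁻¹ * h).1.koopman (f i)) =
        fun h : C => h.1.koopman ((g⁻¹).1.koopman (f i)) := by
      funext h
      exact Aut.koopman_mul _ _ _
    rw [this]
    exact (Aut.continuous_koopman_apply _).comp continuous_subtype_val
  refine mem_of_superset (hopen.mem_nhds fun i => ?_) fun h hh => ?_
  · rw [inv_mul_cancel]
    have : (1 : C).1.koopman (f i) = f i := Aut.koopman_one _
    rwa [this, dist_self]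
  · show (h : C ⧸ H) = q
    rw [← hg]
    exact (QuotientGroup.eq.2 (hH _ hh)).symm

/-- Representatives of distinct cosets send the tuple `f` to points at distance at least `r`, and a
separable space has only countably many such points. -/
theorem countable_quotient [MeasureTheory.IsSeparable μ] [H.Normal] (hr : 0 < r)
    (hH : ∀ S : C, (∀ i, dist (S.1.koopman (f i)) (f i) < r) → S ∈ H) : Countable (C ⧸ H) := by
  have : Fact ((2 : ENNReal) ≠ ⊤) := ⟨by norm_num⟩
  let Φ : C ⧸ H → (Fin k → Lp ℂ 2 μ) := fun q i => (Quotient.out q).1.koopman (f i)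
  choose n hn using fun q => Metric.denseRange_iff.1
    (TopologicalSpace.denseRange_denseSeq (Fin k → Lp ℂ 2 μ)) (Φ q) (r / 2) (half_pos hr)
  refine Function.Injective.countable (f := n) fun a b hab => ?_
  have hd : dist (Φ b) (Φ a) < r := by
    have h1 := hn a
    have h2 := hn b
    rw [← hab] at h2
    have := dist_triangle_right (Φ b) (Φ a) (TopologicalSpace.denseSeq _ (n a))
    linarith
  have hmem : Quotient.out b * (Quotient.out a)⁻¹ ∈ H := by
    refine hH _ fun i => ?_
    have := Aut.dist_koopman_inv_mul (Quotient.out a).1 (Quotient.out b).1 (f i)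
    exact this.trans_lt ((dist_le_pi_dist (Φ b) (Φ a) i).trans_lt hd)
  -- The Koopman operators compose in reverse order, so the isometry argument yields `b * a⁻¹`;
  -- normality converts it to the product that compares left cosets.
  have hmem' : (Quotient.out a)⁻¹ * Quotient.out b ∈ H := ‹H.Normal›.mem_comm hmem
  rw [← QuotientGroup.out_eq' a, ← QuotientGroup.out_eq' b]
  exact QuotientGroup.eq.2 hmem'

end Subgroups

/-- On this set the indicator of `A` and its composition with `e` differ by exactly `1`, and the
`L¹` norm is at most the `L²` norm. -/
theorem measureReal_diff_preimage_le [IsProbabilityMeasure μ] {A : Set X} (hA : MeasurableSet A)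
    (e : mpPerm μ) :
    μ.real (A \ (fun x => e.1 x) ⁻¹' A) ≤
      dist ((Aut.mk μ e).koopman (indicatorConstLp 2 hA (measure_ne_top μ A) (1 : ℂ)))
        (indicatorConstLp 2 hA (measure_ne_top μ A) (1 : ℂ)) := by
  set g := indicatorConstLp 2 hA (measure_ne_top μ A) (1 : ℂ) with hg
  have hgA : g =ᵐ[μ] A.indicator fun _ => (1 : ℂ) := indicatorConstLp_coeFn
  rw [dist_eq_norm, Aut.koopman_mk]
  refine le_trans ?_ (integral_norm_le_norm_Lp_two _)
  have hint := (integrable_Lp_two (Lp.compMeasurePreserving (fun x => e.1 x) e.2.1 g - g)).norm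
  have hm : MeasurableSet (A \ (fun x => e.1 x) ⁻¹' A) := hA.diff (e.2.1.measurable hA)
  rw [← mul_one (μ.real _), ← smul_eq_mul, ← integral_indicator_const _ hm]
  refine integral_mono_ae ((integrable_const 1).indicator hm) hint ?_
  filter_upwards [hgA, e.2.1.quasiMeasurePreserving.ae hgA,
    Lp.coeFn_sub (Lp.compMeasurePreserving (fun x => e.1 x) e.2.1 g) g,
    Lp.coeFn_compMeasurePreserving g e.2.1] with x h1 h2 h3 h4
  rw [h3, Pi.sub_apply, h4, Function.comp_apply, h2, h1]
  by_cases hx : x ∈ A \ (fun x => e.1 x) ⁻¹' A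
  · have hx2 : e.1 x ∉ A := hx.2
    simp [hx.1, hx2]
  · rw [indicator_of_notMem hx]
    exact norm_nonneg _

/-- Strong convergence to the identity implies convergence in measure: `S` moves most points
little, as measured by `φ`, if finitely many indicator functions are moved little. -/
theorem exists_koopman_dist_lt [IsProbabilityMeasure μ] {Y : Type v} [PseudoMetricSpace Y]
    [TopologicalSpace.SeparableSpace Y] [MeasurableSpace Y] [OpensMeasurableSpace Y] {φ : X → Y}
    (hφ : Measurable φ) {δ η : ℝ} (hδ : 0 < δ) (hη : 0 < η) :
    ∃ (k : ℕ) (f : Fin k → Lp ℂ 2 μ) (r : ℝ), 0 < r ∧ ∀ e : mpPerm μ,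
      (∀ i, dist ((Aut.mk μ e).koopman (f i)) (f i) < r) →
        μ.real {x | δ ≤ dist (φ x) (φ (e.1 x))} < η := by
  have : Nonempty Y := (nonempty_of_isProbabilityMeasure μ).map φ
  set A : ℕ → Set X := fun i => φ ⁻¹' Metric.ball (TopologicalSpace.denseSeq Y i) (δ / 2) with hAdef
  have hA : ∀ i, MeasurableSet (A i) := fun i => hφ Metric.isOpen_ball.measurableSet
  have hlim := tendsto_measure_iInter_atTop (μ := μ) (s := fun k : ℕ => {x | ∀ i < k, x ∉ A i})
    (fun k => by
      have : {x | ∀ i < k, x ∉ A i} = ⋂ i, ⋂ (_ : i < k), (A i)ᶜ := by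
        ext x
        simp
      rw [this]
      exact (MeasurableSet.iInter fun i => MeasurableSet.iInter fun _ =>
        (hA i).compl).nullMeasurableSet)
    (fun i j hij x hx l hl => hx l (hl.trans_le hij)) ⟨0, measure_ne_top _ _⟩
  have hempty : ⋂ k : ℕ, {x | ∀ i < k, x ∉ A i} = ∅ := by
    refine eq_empty_of_forall_notMem fun x hx => ?_
    obtain ⟨i, hi⟩ := Metric.denseRange_iff.1 (TopologicalSpace.denseRange_denseSeq Y) (φ x) (δ / 2)
      (half_pos hδ)
    exact mem_iInter.1 hx (i + 1) i (Nat.lt_succ_self i) hi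
  rw [hempty, measure_empty] at hlim
  -- Finitely many balls of radius `δ / 2` capture all but `η / 2` of the mass; a point that stays
  -- in its ball under `e` moves less than `δ`.
  obtain ⟨k, hk⟩ := (((ENNReal.tendsto_toReal ENNReal.zero_ne_top).comp hlim).eventually
    (gt_mem_nhds (show ENNReal.toReal 0 < η / 2 by simpa using hη))).exists
  have hk : μ.real {x | ∀ i < k, x ∉ A i} < η / 2 := hk
  refine ⟨k, fun i => indicatorConstLp 2 (hA i) (measure_ne_top μ _) (1 : ℂ),
    η / (2 * (k + 1)), by positivity, fun e he => ?_⟩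
  have hsub : {x | δ ≤ dist (φ x) (φ (e.1 x))} ⊆
      {x | ∀ i < k, x ∉ A i} ∪ ⋃ i ∈ (Finset.univ : Finset (Fin k)),
        (A i \ (fun x => e.1 x) ⁻¹' A i) := by
    intro x hx
    by_contra hcon
    simp only [mem_union, mem_ofPred_eq, mem_iUnion, Finset.mem_univ, Set.mem_sdiff, mem_preimage,
      not_or, not_forall, not_not, not_exists, not_and, exists_prop, true_and] at hcon
    obtain ⟨⟨i, hik, hi⟩, h2⟩ := hcon
    have h3 : dist (φ x) _ < δ / 2 := hi
    have h4 : dist (φ (e.1 x)) _ < δ / 2 := h2 ⟨i, hik⟩ hi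
    have h5 := dist_triangle_right (φ x) (φ (e.1 x)) (TopologicalSpace.denseSeq Y i)
    have hx : δ ≤ dist (φ x) (φ (e.1 x)) := hx
    linarith
  have hsum : μ.real (⋃ i ∈ (Finset.univ : Finset (Fin k)), (A i \ (fun x => e.1 x) ⁻¹' A i)) ≤
      k * (η / (2 * (k + 1))) := by
    have hi : ∀ i ∈ (Finset.univ : Finset (Fin k)),
        μ.real (A i \ (fun x => e.1 x) ⁻¹' A i) ≤ η / (2 * (k + 1)) := fun i _ =>
      (measureReal_diff_preimage_le (hA i) e).trans (he i).le
    refine (measureReal_biUnion_finset_le _ _).trans ((Finset.sum_le_sum hi).trans ?_)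
    simp
  have hle : k * (η / (2 * (k + 1))) ≤ η / 2 := by
    rw [← mul_div_assoc, div_le_div_iff₀ (by positivity) (by positivity)]
    nlinarith
  have := (measureReal_mono (μ := μ) hsub).trans (measureReal_union_le _ _)
  linarith

end StrongTopology

/-! ### From classes in the centralizer to pointwise maps. -/

section EssentialCentralizer

variable {X : Type u} [MeasurableSpace X] [AddAction ℝ X] [MeasurableVAdd₂ ℝ X] {μ : Measure X}
  [VAddInvariantMeasure ℝ X μ]

theorem ae_apply_vadd_of_mk_mem_centralizer {e : mpPerm μ} (he : Aut.mk μ e ∈ centralizer μ)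
    (t : ℝ) : ∀ᵐ x ∂μ, e.1 (t +ᵥ x) = t +ᵥ e.1 x := by
  have h : Aut.mk μ (timePerm μ t) * Aut.mk μ e = Aut.mk μ e * Aut.mk μ (timePerm μ t) :=
    Subgroup.mem_centralizer_iff.1 he _ ⟨Multiplicative.ofAdd t, rfl⟩
  rw [← map_mul, ← map_mul, Aut.mk_eq_mk_iff] at h
  filter_upwards [h] with x hx using hx.symm

theorem mem_timeSubgroup_of_ae_eq {S : centralizer μ} {e : mpPerm μ} (hS : Aut.mk μ e = S.1)
    {c : ℝ} (hc : ∀ᵐ x ∂μ, e.1 x = c +ᵥ x) : S ∈ timeSubgroup μ := by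
  refine Subgroup.mem_subgroupOf.2 ⟨Multiplicative.ofAdd c, ?_⟩
  rw [← hS]
  refine (Aut.mk_eq_mk_iff _ _).2 ?_
  filter_upwards [hc] with x hx using hx.symm

end EssentialCentralizer

end RatnerFlow

theorem theorem1 {X : Type u} [MeasurableSpace X] [StandardBorelSpace X]
    (μ : MeasureTheory.Measure X) [MeasureTheory.IsProbabilityMeasure μ]
    [AddAction ℝ X] [MeasurableVAdd₂ ℝ X] [ErgodicVAdd ℝ X μ]
    (hfree : RatnerFlow.IsFree μ)
    (hRatner : RatnerFlow.HasRatnerProperty.{u, v} μ) :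
    DiscreteTopology (RatnerFlow.EssentialCentralizer μ) ∧
      Countable (RatnerFlow.EssentialCentralizer μ) := by
  obtain ⟨P, Y, _, _, _, _, _, _, ν, _, _, ⟨φ, ψ, hφ, hψ, hψφ, -, hφT⟩, hP, hunc⟩ := hRatner
  have : SecondCountableTopology Y := inferInstance
  obtain ⟨t₀, -, hR⟩ : {s : ℝ | s ≠ 0 ∧ RatnerFlow.PropertyR ν s P}.Nonempty :=
    nonempty_iff_ne_empty.2 fun h => hunc (h ▸ countable_empty)
  obtain ⟨δ, hδ, η, hη, hgap⟩ :=
    RatnerFlow.exists_le_measure_dist hfree hφ hψ.measurable hψφ hφT hP hR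
  obtain ⟨k, f, r, hr, hf⟩ := RatnerFlow.exists_koopman_dist_lt (μ := μ) hφ.measurable hδ hη
  have hH : ∀ S : RatnerFlow.centralizer μ, (∀ i, dist (S.1.koopman (f i)) (f i) < r) →
      S ∈ RatnerFlow.timeSubgroup μ := by
    intro S hS
    obtain ⟨e, he⟩ := RatnerFlow.Aut.mk_surjective S.1
    have hcomm := RatnerFlow.ae_apply_vadd_of_mk_mem_centralizer (μ := μ) (e := e) (he ▸ S.2)
    rw [← he] at hS
    -- If `e` preserved no orbit, the gap would contradict its closeness to the identity in measure;
    -- so it moves a non-null set along orbits.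
    obtain ⟨c, hc⟩ := RatnerFlow.exists_ae_eq_vadd hfree e.2.1.measurable hcomm fun hne =>
      (hf e hS).not_ge (hgap _ e.2.1 hcomm hne)
    exact RatnerFlow.mem_timeSubgroup_of_ae_eq he hc
  exact ⟨RatnerFlow.discreteTopology_quotient hr hH, RatnerFlow.countable_quotient hr hH⟩
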